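/- Let $D\subset\mathbb{C}^n$ be a bounded homogeneous domain, i.e. a bounded domain on which the group of biholomorphic self-maps acts transitively, and fix $z_0\in D$. Let $K_D$ be the Bergman kernel of $D$ (the reproducing kernel of the space of square integrable holomorphic functions on $D$) and let $$H_z(u,\bar v)=\frac12\sum_{j,k=1}^n\frac{\partial^2\log K_D(z,z)}{\partial z_j\,\partial\bar z_k}\,u_j\bar v_k$$ be the Bergman metric of $D$. For $f$ holomorphic on $D$ put $$Q_f(z)=\sup_{u\in\mathbb{C}^n\setminus\{0\}}\frac{\bigl|\sum_{j=1}^n\frac{\partial f}{\partial z_j}(z)u_j\bigr|}{H_z(u,\bar u)^{1/2}},\qquad \beta_f=\sup_{z\in D}Q_f(z).$$ The Bloch space $\mathcal{B}(D)$ is the space of all holomorphic $f:D\to\mathbb{C}$ with $\beta_f<\infty$, with norm $\|f\|=|f(z_0)|+\beta_f$. The $*$-little Bloch space $\mathcal{B}_{0^*}(D)$ is the subspace, with the same norm, of all $f\in\mathcal{B}(D)$ such that $Q_f(z)\to0$ as $z\in D$ tends to the distinguished boundary $\partial^*D$, that is, the Shilov boundary of $D$: the smallest closed subset of $\overline D$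 on which every function that is continuous on $\overline D$ and holomorphic in $D$ attains its maximum modulus over $\overline D$. Let $\psi:D\to\mathbb{C}$ be holomorphic and let $X$ be $\mathcal{B}(D)$ or $\mathcal{B}_{0^*}(D)$. If the multiplication operator $M_\psi f=\psi f$ maps $X$ into $X$ and is bounded on $X$, then its spectrum $$\sigma(M_\psi)=\{\lambda\in\mathbb{C}: M_\psi-\lambda I\text{ is not invertible in the algebra of bounded operators on }X\}$$ satisfies $$\sigma(M_\psi)=\overline{\psi(D)},$$ where the closure is taken in $\mathbb{C}$. -/

import Mathlib

open Set Filter Topology MeasureTheory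
open scoped ENNReal ComplexConjugate

noncomputable section

namespace BlochSpaces

/-- A bounded homogeneous domain in `ℂⁿ`: a bounded, open, connected, nonempty set on which the
group of biholomorphic self-maps acts transitively. -/
structure BoundedHomogeneousDomain (n : ℕ) where
  carrier : Set (Fin n → ℂ)
  isOpen : IsOpen carrier
  isConnected : IsConnected carrier
  isBounded : Bornology.IsBounded carrier
  homogeneous : ∀ z ∈ carrier, ∀ w ∈ carrier, ∃ φ χ : (Fin n → ℂ) → (Fin n → ℂ),
    DifferentiableOn ℂ φ carrier ∧ DifferentiableOn ℂ χ carrier ∧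
    MapsTo φ carrier carrier ∧ MapsTo χ carrier carrier ∧
    InvOn χ φ carrier carrier ∧ φ z = w

variable {n : ℕ}

/-! ### Bergman kernel and Bergman metric -/

/-- Membership in the Bergman space `A²(D)` of square integrable holomorphic functions
(with respect to Lebesgue measure on `ℂⁿ`). -/
def MemBergman (D : Set (Fin n → ℂ)) (f : (Fin n → ℂ) → ℂ) : Prop :=
  DifferentiableOn ℂ f D ∧ MemLp f 2 (volume.restrict D)

/-- `k` represents evaluation at `w` on `A²(D)`. -/
def Reproduces (D : Set (Fin n → ℂ)) (w : Fin n → ℂ) (k : (Fin n → ℂ) → ℂ) : Prop :=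
  MemBergman D k ∧ ∀ f, MemBergman D f → f w = ∫ z in D, f z * conj (k z)

open Classical in
/-- The Bergman kernel `K_D(z, w)`, i.e. the reproducing kernel of `A²(D)`: for `w ∈ D`, the
function `K_D(·, w)` is the element of `A²(D)` (unique on `D`) representing evaluation at `w`. -/
def bergmanKernel (D : Set (Fin n → ℂ)) (z w : Fin n → ℂ) : ℂ :=
  if h : ∃ k, Reproduces D w k then h.choose z else 0

/-- The Wirtinger derivative `∂φ/∂z_j = (∂φ/∂x_j - i ∂φ/∂y_j) / 2`. -/
def dz (j : Fin n) (φ : (Fin n → ℂ) → ℂ) (z : Fin n → ℂ) : ℂ :=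
  (fderiv ℝ φ z (Pi.single j 1) - Complex.I * fderiv ℝ φ z (Pi.single j Complex.I)) / 2

/-- The Wirtinger derivative `∂φ/∂z̄_j = (∂φ/∂x_j + i ∂φ/∂y_j) / 2`. -/
def dzBar (j : Fin n) (φ : (Fin n → ℂ) → ℂ) (z : Fin n → ℂ) : ℂ :=
  (fderiv ℝ φ z (Pi.single j 1) + Complex.I * fderiv ℝ φ z (Pi.single j Complex.I)) / 2

/-- The Bergman metric
`H_z(u, v̄) = (1/2) ∑_{j,k} (∂² log K_D(z, z) / ∂z_j ∂z̄_k) u_j v̄_k`.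
The factor `1/2` is the normalization for which the unit disk has
`H_z(u, ū) = |u|² / (1 - |z|²)²`. -/
def bergmanMetric (D : Set (Fin n → ℂ)) (z u v : Fin n → ℂ) : ℂ :=
  (1 / 2) * ∑ j, ∑ k,
    dz j (dzBar k fun ζ => ((Real.log (bergmanKernel D ζ ζ).re : ℝ) : ℂ)) z * u j * conj (v k)

/-! ### Bloch functions -/

/-- `∇(f)(z) u = ∑_j (∂f/∂z_j)(z) u_j`. -/
def grad (f : (Fin n → ℂ) → ℂ) (z u : Fin n → ℂ) : ℂ :=
  ∑ j, fderiv ℂ f z (Pi.single j 1) * u j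

/-- `Q_f(z) = sup_{u ≠ 0} |∇(f)(z) u| / H_z(u, ū)^{1/2}`, as an element of `[0, ∞]`. -/
def Q (D : Set (Fin n → ℂ)) (f : (Fin n → ℂ) → ℂ) (z : Fin n → ℂ) : ℝ≥0∞ :=
  ⨆ (u : Fin n → ℂ) (_ : u ≠ 0),
    ENNReal.ofReal ‖grad f z u‖ / ENNReal.ofReal (Real.sqrt (bergmanMetric D z u u).re)

/-- `β_f = sup_{z ∈ D} Q_f(z)`, as an element of `[0, ∞]`. -/
def beta (D : Set (Fin n → ℂ)) (f : (Fin n → ℂ) → ℂ) : ℝ≥0∞ :=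
  ⨆ z ∈ D, Q D f z

theorem grad_add {f g : (Fin n → ℂ) → ℂ} {z : Fin n → ℂ} (hf : DifferentiableAt ℂ f z)
    (hg : DifferentiableAt ℂ g z) (u : Fin n → ℂ) :
    grad (f + g) z u = grad f z u + grad g z u := by
  simp only [grad, fderiv_add hf hg, add_apply, add_mul,
    Finset.sum_add_distrib]

theorem grad_smul {f : (Fin n → ℂ) → ℂ} {z : Fin n → ℂ} (hf : DifferentiableAt ℂ f z)
    (c : ℂ) (u : Fin n → ℂ) : grad (c • f) z u = c * grad f z u := by
  simp only [grad, fderiv_const_smul hf c, smul_apply, smul_eq_mul,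
    Finset.mul_sum, mul_assoc]

theorem Q_add_le (D : Set (Fin n → ℂ)) {f g : (Fin n → ℂ) → ℂ} {z : Fin n → ℂ}
    (hf : DifferentiableAt ℂ f z) (hg : DifferentiableAt ℂ g z) :
    Q D (f + g) z ≤ Q D f z + Q D g z := by
  refine iSup₂_le fun u hu => ?_
  refine le_trans ?_ (add_le_add
    (le_iSup₂ (f := fun (u : Fin n → ℂ) (_ : u ≠ 0) => ENNReal.ofReal ‖grad f z u‖ /
      ENNReal.ofReal (Real.sqrt (bergmanMetric D z u u).re)) u hu)
    (le_iSup₂ (f := fun (u : Fin n → ℂ) (_ : u ≠ 0) => ENNReal.ofReal ‖grad g z u‖ /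
      ENNReal.ofReal (Real.sqrt (bergmanMetric D z u u).re)) u hu))
  rw [← ENNReal.add_div, ← ENNReal.ofReal_add (norm_nonneg _) (norm_nonneg _), grad_add hf hg]
  gcongr
  exact norm_add_le _ _

theorem Q_smul (D : Set (Fin n → ℂ)) {f : (Fin n → ℂ) → ℂ} {z : Fin n → ℂ}
    (hf : DifferentiableAt ℂ f z) (c : ℂ) :
    Q D (c • f) z = ENNReal.ofReal ‖c‖ * Q D f z := by
  simp only [Q, ENNReal.mul_iSup, grad_smul hf, norm_mul, ENNReal.ofReal_mul (norm_nonneg c),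
    mul_div_assoc]

theorem Q_zero (D : Set (Fin n → ℂ)) (z : Fin n → ℂ) : Q D 0 z = 0 := by
  have h := Q_smul D (f := 0) (z := z) (differentiableAt_const (0 : ℂ)) 0
  simpa using h

theorem beta_add_le {D : Set (Fin n → ℂ)} (hD : IsOpen D) {f g : (Fin n → ℂ) → ℂ}
    (hf : DifferentiableOn ℂ f D) (hg : DifferentiableOn ℂ g D) :
    beta D (f + g) ≤ beta D f + beta D g := by
  refine iSup₂_le fun z hz => ?_
  refine (Q_add_le D (hf.differentiableAt (hD.mem_nhds hz))
    (hg.differentiableAt (hD.mem_nhds hz))).trans (add_le_add ?_ ?_)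
  · exact le_iSup₂ (f := fun z (_ : z ∈ D) => Q D f z) z hz
  · exact le_iSup₂ (f := fun z (_ : z ∈ D) => Q D g z) z hz

theorem beta_smul {D : Set (Fin n → ℂ)} (hD : IsOpen D) {f : (Fin n → ℂ) → ℂ}
    (hf : DifferentiableOn ℂ f D) (c : ℂ) :
    beta D (c • f) = ENNReal.ofReal ‖c‖ * beta D f := by
  simp only [beta, ENNReal.mul_iSup]
  exact iSup_congr fun z => iSup_congr fun hz => Q_smul D (hf.differentiableAt (hD.mem_nhds hz)) c

theorem beta_zero (D : Set (Fin n → ℂ)) : beta D 0 = 0 := by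
  simp [beta, Q_zero]

theorem grad_eq_fderiv (f : (Fin n → ℂ) → ℂ) (z u : Fin n → ℂ) :
    grad f z u = fderiv ℂ f z u := by
  conv_rhs => rw [pi_eq_sum_univ' u, map_sum]
  refine Finset.sum_congr rfl fun j _ => ?_
  rw [map_smul, smul_eq_mul, mul_comm]

theorem fderiv_eq_zero_of_beta_eq_zero {D : Set (Fin n → ℂ)} {f : (Fin n → ℂ) → ℂ}
    (h : beta D f = 0) {z : Fin n → ℂ} (hz : z ∈ D) : fderiv ℂ f z = 0 := by
  ext1 u
  by_cases hu : u = 0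
  · simp [hu]
  have h1 : Q D f z = 0 := by
    have := le_iSup₂ (f := fun z (_ : z ∈ D) => Q D f z) z hz
    exact le_antisymm (this.trans h.le) bot_le
  have h2 := (le_iSup₂ (f := fun (u : Fin n → ℂ) (_ : u ≠ 0) => ENNReal.ofReal ‖grad f z u‖ /
      ENNReal.ofReal (Real.sqrt (bergmanMetric D z u u).re)) u hu).trans h1.le
  have h3 := ENNReal.div_eq_zero_iff.1 (le_antisymm h2 bot_le)
  rcases h3 with h3 | h3
  · rw [ENNReal.ofReal_eq_zero] at h3
    simpa [grad_eq_fderiv] using h3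
  · exact absurd h3 ENNReal.ofReal_ne_top

/-! ### The Bloch space -/

/-- The vector space of Bloch functions on `D`. A function on `D` is represented by its extension
by `0` to `ℂⁿ`, so that equality in this space is equality of functions on `D`. -/
def blochFunctions (D : BoundedHomogeneousDomain n) : Submodule ℂ ((Fin n → ℂ) → ℂ) where
  carrier := {f | DifferentiableOn ℂ f D.carrier ∧ (∀ z ∉ D.carrier, f z = 0) ∧
    beta D.carrier f < ∞}
  zero_mem' := ⟨differentiableOn_const _, fun _ _ => rfl, by simp [beta_zero]⟩
  add_mem' := by
    rintro f g ⟨hf, hf0, hfb⟩ ⟨hg, hg0, hgb⟩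
    refine ⟨hf.add hg, fun z hz => by simp [hf0 z hz, hg0 z hz], ?_⟩
    exact (beta_add_le D.isOpen hf hg).trans_lt (ENNReal.add_lt_top.2 ⟨hfb, hgb⟩)
  smul_mem' := by
    rintro c f ⟨hf, hf0, hfb⟩
    refine ⟨hf.const_smul c, fun z hz => by simp [hf0 z hz], ?_⟩
    rw [beta_smul D.isOpen hf]
    exact ENNReal.mul_lt_top ENNReal.ofReal_lt_top hfb

/-- The Bloch space `𝓑(D)` based at `z₀ ∈ D`; its norm is
`‖f‖ = |f(z₀)| + β_f`, see the instances below. -/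
def BlochSpace (D : BoundedHomogeneousDomain n) (_z₀ : D.carrier) : Type :=
  blochFunctions D

variable {D : BoundedHomogeneousDomain n} {z₀ : D.carrier}

instance : AddCommGroup (BlochSpace D z₀) := inferInstanceAs (AddCommGroup (blochFunctions D))

instance : Module ℂ (BlochSpace D z₀) := inferInstanceAs (Module ℂ (blochFunctions D))

/-- The function on `ℂⁿ` (zero outside `D`) underlying an element of the Bloch space. -/
def BlochSpace.toFun (f : BlochSpace D z₀) : (Fin n → ℂ) → ℂ :=
  Subtype.val (p := fun f => f ∈ blochFunctions D) f

instance : CoeFun (BlochSpace D z₀) (fun _ => (Fin n → ℂ) → ℂ) := ⟨BlochSpace.toFun⟩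

theorem BlochSpace.mem (f : BlochSpace D z₀) : f.toFun ∈ blochFunctions D :=
  Subtype.property (p := fun f => f ∈ blochFunctions D) f

theorem BlochSpace.toFun_injective :
    Function.Injective (BlochSpace.toFun : BlochSpace D z₀ → (Fin n → ℂ) → ℂ) :=
  Subtype.val_injective

theorem BlochSpace.toFun_zero : (0 : BlochSpace D z₀).toFun = 0 := rfl

theorem BlochSpace.toFun_add (f g : BlochSpace D z₀) :
    (f + g).toFun = f.toFun + g.toFun := rfl

theorem BlochSpace.toFun_smul (c : ℂ) (f : BlochSpace D z₀) :
    (c • f).toFun = c • f.toFun := rfl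

instance : Norm (BlochSpace D z₀) := ⟨fun f => ‖f z₀‖ + (beta D.carrier f).toReal⟩

theorem BlochSpace.norm_def (f : BlochSpace D z₀) :
    ‖f‖ = ‖f z₀‖ + (beta D.carrier f).toReal := rfl

theorem BlochSpace.normCore : NormedSpace.Core ℂ (BlochSpace D z₀) where
  norm_nonneg f := add_nonneg (norm_nonneg _) ENNReal.toReal_nonneg
  norm_smul c f := by
    rw [norm_def, norm_def, toFun_smul, beta_smul D.isOpen f.mem.1, ENNReal.toReal_mul,
      ENNReal.toReal_ofReal (norm_nonneg c), Pi.smul_apply, norm_smul, mul_add]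
  norm_triangle f g := by
    have h := ENNReal.toReal_mono (ENNReal.add_ne_top.2 ⟨f.mem.2.2.ne, g.mem.2.2.ne⟩)
      (beta_add_le D.isOpen f.mem.1 g.mem.1)
    rw [ENNReal.toReal_add f.mem.2.2.ne g.mem.2.2.ne] at h
    have h' := norm_add_le (f z₀) (g z₀)
    simp only [norm_def, toFun_add, Pi.add_apply]
    linarith
  norm_eq_zero_iff f := by
    constructor
    · intro h
      rw [norm_def] at h
      have h1 : ‖f z₀‖ = 0 := by
        linarith [norm_nonneg (f z₀), ENNReal.toReal_nonneg (a := beta D.carrier f)]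
      have h2 : (beta D.carrier f).toReal = 0 := by linarith
      have h3 : beta D.carrier f = 0 :=
        (ENNReal.toReal_eq_zero_iff _).1 h2 |>.resolve_right f.mem.2.2.ne
      apply toFun_injective
      funext z
      by_cases hz : z ∈ D.carrier
      · have := D.isOpen.is_const_of_fderiv_eq_zero D.isConnected.isPreconnected f.mem.1
          (fun w hw => fderiv_eq_zero_of_beta_eq_zero h3 hw) hz z₀.2
        rw [this, norm_eq_zero.1 h1]
        rfl
      · exact f.mem.2.1 z hz
    · rintro rfl
      simp [norm_def, toFun_zero, beta_zero]

instance : NormedAddCommGroup (BlochSpace D z₀) :=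
  NormedAddCommGroup.ofCore BlochSpace.normCore

instance : NormedSpace ℂ (BlochSpace D z₀) := NormedSpace.ofCore BlochSpace.normCore

/-! ### The `*`-little Bloch space -/

/-- The distinguished (Shilov) boundary `∂*D`: the smallest closed subset of the closure of `D`
on which every function continuous on the closure of `D` and holomorphic in `D` attains its
maximum modulus. -/
def distinguishedBoundary (D : Set (Fin n → ℂ)) : Set (Fin n → ℂ) :=
  ⋂₀ {S | IsClosed S ∧ S ⊆ closure D ∧
    ∀ f : (Fin n → ℂ) → ℂ, ContinuousOn f (closure D) → DifferentiableOn ℂ f D →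
      ∀ z ∈ closure D, ∃ s ∈ S, ‖f z‖ ≤ ‖f s‖}

/-- The `*`-little Bloch space `𝓑_{0*}(D)`: the Bloch functions `f` with `Q_f(z) → 0` as
`z ∈ D` tends to the distinguished boundary; it carries the norm of the Bloch space. -/
def StarLittleBlochSpace (D : BoundedHomogeneousDomain n) (z₀ : D.carrier) :
    Submodule ℂ (BlochSpace D z₀) where
  carrier := {f | Tendsto (Q D.carrier f) (𝓝ˢ (distinguishedBoundary D.carrier) ⊓ 𝓟 D.carrier)
    (𝓝 0)}
  zero_mem' := by
    have : Q D.carrier (0 : BlochSpace D z₀).toFun = fun _ => 0 := funext (Q_zero _)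
    rw [mem_ofPred_eq, this]
    exact tendsto_const_nhds
  add_mem' := by
    intro f g hf hg
    have h := Tendsto.add hf hg
    rw [add_zero] at h
    refine tendsto_of_tendsto_of_tendsto_of_le_of_le' tendsto_const_nhds h
      (Eventually.of_forall fun _ => zero_le) ?_
    filter_upwards [mem_inf_of_right (mem_principal_self D.carrier)] with z hz
    exact Q_add_le D.carrier (f.mem.1.differentiableAt (D.isOpen.mem_nhds hz))
      (g.mem.1.differentiableAt (D.isOpen.mem_nhds hz))
  smul_mem' := by
    intro c f hf
    have h := ENNReal.Tendsto.const_mul (a := ENNReal.ofReal ‖c‖) hf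
      (Or.inr ENNReal.ofReal_ne_top)
    rw [mul_zero] at h
    refine h.congr' ?_
    filter_upwards [mem_inf_of_right (mem_principal_self D.carrier)] with z hz
    exact (Q_smul D.carrier (f.mem.1.differentiableAt (D.isOpen.mem_nhds hz)) c).symm

/-! ### Multiplication operators -/

/-- The bounded operator `T` on `𝓑(D)` is the multiplication operator `M_ψ : f ↦ ψ f`. -/
def IsMulOperator (ψ : (Fin n → ℂ) → ℂ) (T : BlochSpace D z₀ →L[ℂ] BlochSpace D z₀) : Prop :=
  ∀ f : BlochSpace D z₀, ∀ z ∈ D.carrier, T f z = ψ z * f z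

/-- The bounded operator `T` on `𝓑_{0*}(D)` is the multiplication operator `M_ψ : f ↦ ψ f`. -/
def IsStarLittleMulOperator (ψ : (Fin n → ℂ) → ℂ)
    (T : StarLittleBlochSpace D z₀ →L[ℂ] StarLittleBlochSpace D z₀) : Prop :=
  ∀ f : StarLittleBlochSpace D z₀, ∀ z ∈ D.carrier,
    (T f : BlochSpace D z₀) z = ψ z * (f : BlochSpace D z₀) z

end BlochSpaces

end

namespace BlochSpaces

variable {n : ℕ}

/-! Both spaces are treated at once as a space `X` with an isometry `ι` into the Bloch space. The
Bergman metric enters only through formal properties of `Q`: subadditivity, homogeneity, and `Q D f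
z = 0` only when the derivative vanishes.

If `c - T` is invertible, its inverse is multiplication by `(c - ψ)⁻¹`. The symbol `g` of a bounded
multiplication operator `S` satisfies `‖g‖ ≤ ‖S‖` (`norm_symbol_le`): applying `S ^ k` to the
constant `1` gives `k * |g| ^ (k - 1) * Q_g ≤ ‖S‖ ^ k`, so letting `k` grow kills the derivative of
`g` wherever `|g| > ‖S‖`, and connectedness finishes. Hence `c - ψ` stays away from `0`.

Conversely, if `|c - ψ| ≥ δ > 0`, the derivative of `f / (c - ψ)` is a combination of those of `f`
and `ψ f` with bounded coefficients (`fderiv_resolvent_mul`). Since `ψ f = T f` lies in `X`,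
division by `c - ψ` is a bounded operator on `X`. -/

theorem Q_congr_fderiv (D : Set (Fin n → ℂ)) {f g : (Fin n → ℂ) → ℂ} {z : Fin n → ℂ}
    (h : fderiv ℂ f z = fderiv ℂ g z) : Q D f z = Q D g z := by
  simp only [Q, grad, h]

theorem Q_le_of_fderiv_eq (D : Set (Fin n → ℂ)) {f g h : (Fin n → ℂ) → ℂ} {z : Fin n → ℂ}
    (hf : DifferentiableAt ℂ f z) (hg : DifferentiableAt ℂ g z) {a b : ℂ}
    (e : fderiv ℂ h z = a • fderiv ℂ f z + b • fderiv ℂ g z) :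
    Q D h z ≤ ENNReal.ofReal ‖a‖ * Q D f z + ENNReal.ofReal ‖b‖ * Q D g z := by
  have e' : fderiv ℂ h z = fderiv ℂ (a • f + b • g) z := by
    rw [fderiv_add (hf.const_smul a) (hg.const_smul b), fderiv_const_smul hf,
      fderiv_const_smul hg, e]
  rw [Q_congr_fderiv D e', ← Q_smul D hf, ← Q_smul D hg]
  exact Q_add_le D (hf.const_smul a) (hg.const_smul b)

theorem Q_le_beta {D : Set (Fin n → ℂ)} (f : (Fin n → ℂ) → ℂ) {z : Fin n → ℂ} (hz : z ∈ D) :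
    Q D f z ≤ beta D f :=
  le_iSup₂ (f := fun z (_ : z ∈ D) => Q D f z) z hz

/-- The denominators are values of `ENNReal.ofReal`, never `∞`, so a zero quotient forces a zero
numerator, even if the metric degenerates. -/
theorem Q_ne_zero (D : Set (Fin n → ℂ)) {f : (Fin n → ℂ) → ℂ} {z : Fin n → ℂ}
    (h : fderiv ℂ f z ≠ 0) : Q D f z ≠ 0 := by
  contrapose! h
  ext1 u
  by_cases hu : u = 0
  · simp [hu]
  have h1 := (le_iSup₂ (f := fun (u : Fin n → ℂ) (_ : u ≠ 0) => ENNReal.ofReal ‖grad f z u‖ /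
    ENNReal.ofReal (Real.sqrt (bergmanMetric D z u u).re)) u hu).trans h.le
  rcases ENNReal.div_eq_zero_iff.1 (le_antisymm h1 bot_le) with h2 | h2
  · simpa [grad_eq_fderiv] using ENNReal.ofReal_eq_zero.1 h2
  · exact absurd h2 ENNReal.ofReal_ne_top

variable {D : BoundedHomogeneousDomain n} {z₀ : D.carrier}

theorem BlochSpace.differentiableAt (f : BlochSpace D z₀) {z : Fin n → ℂ} (hz : z ∈ D.carrier) :
    DifferentiableAt ℂ f.toFun z :=
  f.mem.1.differentiableAt (D.isOpen.mem_nhds hz)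

theorem BlochSpace.ext_on {f g : BlochSpace D z₀} (h : ∀ z ∈ D.carrier, f z = g z) : f = g := by
  apply toFun_injective
  funext z
  by_cases hz : z ∈ D.carrier
  · exact h z hz
  · rw [f.mem.2.1 z hz, g.mem.2.1 z hz]

theorem BlochSpace.toReal_beta_le_norm (f : BlochSpace D z₀) :
    (beta D.carrier f).toReal ≤ ‖f‖ := by
  rw [norm_def]
  linarith [norm_nonneg (f z₀)]

theorem BlochSpace.norm_apply_base_le_norm (f : BlochSpace D z₀) : ‖f z₀‖ ≤ ‖f‖ := by
  rw [norm_def]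
  linarith [ENNReal.toReal_nonneg (a := beta D.carrier f)]

/-- A holomorphic function whose derivative vanishes wherever its modulus exceeds `C` is bounded
by `C`, provided it is so at one point. -/
theorem norm_le_of_fderiv_eq_zero {U : Set (Fin n → ℂ)} (hU : IsOpen U) (hc : IsPreconnected U)
    {g : (Fin n → ℂ) → ℂ} (hg : DifferentiableOn ℂ g U) {C : ℝ}
    (h : ∀ z ∈ U, C < ‖g z‖ → fderiv ℂ g z = 0) {w : Fin n → ℂ} (hw : w ∈ U) (hgw : ‖g w‖ ≤ C)
    {z : Fin n → ℂ} (hz : z ∈ U) : ‖g z‖ ≤ C := by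
  by_contra! hlt
  -- The level set of `g z` is clopen in `U`: near each of its points the modulus still exceeds `C`,
  -- so `g` is locally constant there. It omits `w`, against connectedness.
  have hopen1 : IsOpen (U ∩ g ⁻¹' {g z}) := by
    rw [Metric.isOpen_iff]
    rintro x ⟨hx, hxz : g x = g z⟩
    have hV : IsOpen (U ∩ g ⁻¹' {y | C < ‖y‖}) :=
      hg.continuousOn.isOpen_inter_preimage hU (isOpen_lt continuous_const continuous_norm)
    obtain ⟨ε, hε, hb⟩ := Metric.isOpen_iff.1 hV x ⟨hx, by simpa [hxz] using hlt⟩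
    refine ⟨ε, hε, fun y hy => ⟨(hb hy).1, ?_⟩⟩
    have := Metric.isOpen_ball.is_const_of_fderiv_eq_zero
      (convex_ball x ε).isPreconnected (hg.mono fun t ht => (hb ht).1)
      (fun t ht => h t (hb ht).1 (hb ht).2) hy (Metric.mem_ball_self hε)
    exact this.trans hxz
  have hopen2 : IsOpen (U ∩ g ⁻¹' {g z}ᶜ) :=
    hg.continuousOn.isOpen_inter_preimage hU isOpen_compl_singleton
  obtain ⟨x, -, ⟨-, h1⟩, -, h2⟩ := hc _ _ hopen1 hopen2
    (fun x hx => (em (g x = g z)).imp (fun e => ⟨hx, e⟩) (fun e => ⟨hx, e⟩))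
    ⟨z, hz, hz, rfl⟩ ⟨w, hw, hw, fun e : g w = g z => by rw [e] at hgw; linarith⟩
  exact h2 h1

/-! ### Symbols of multiplication operators and the range inside the spectrum -/

section Embedded

variable {X : Type*} [NormedAddCommGroup X] [NormedSpace ℂ X] {ι : X →ₗᵢ[ℂ] BlochSpace D z₀}

/-- The symbol of a bounded multiplication operator is bounded by the norm of the operator. -/
theorem norm_symbol_le {e : X} (he : ∀ z ∈ D.carrier, ι e z = 1) {g : (Fin n → ℂ) → ℂ}
    (hg : DifferentiableOn ℂ g D.carrier) (S : X →L[ℂ] X)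
    (hS : ∀ x, ∀ z ∈ D.carrier, ι (S x) z = g z * ι x z) {z : Fin n → ℂ} (hz : z ∈ D.carrier) :
    ‖g z‖ ≤ ‖S‖ := by
  have hpow : ∀ k : ℕ, ∀ z ∈ D.carrier, ι ((S ^ k) e) z = g z ^ k := by
    intro k
    induction k with
    | zero => intro z hz; simpa using he z hz
    | succ k ih =>
      intro z hz
      rw [pow_succ' S, mul_apply_eq_comp, hS _ z hz, ih z hz, pow_succ']
  have hne : ‖e‖ = 1 := by
    have hb : beta D.carrier (ι e) = 0 := by
      refine le_antisymm (iSup₂_le fun z hz => ?_) bot_le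
      rw [Q_congr_fderiv (g := fun _ => 1), Q_congr_fderiv (g := 0), Q_zero]
      · simp
      · exact (Filter.eventuallyEq_of_mem (D.isOpen.mem_nhds hz) he).fderiv_eq
    rw [← ι.norm_map, BlochSpace.norm_def, hb, he _ z₀.2]
    simp
  have hnorm : ∀ k : ℕ, ‖ι ((S ^ k) e)‖ ≤ ‖S‖ ^ k := by
    intro k
    rw [ι.norm_map]
    induction k with
    | zero => simp [hne]
    | succ k ih =>
      rw [pow_succ' S, mul_apply_eq_comp, pow_succ']
      exact (S.le_opNorm _).trans (by gcongr)
  refine norm_le_of_fderiv_eq_zero D.isOpen D.isConnected.isPreconnected hg ?_ z₀.2 ?_ hz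
  · intro z hz hlt
    by_contra hd
    have hgz : 0 < ‖g z‖ := (norm_nonneg _).trans_lt hlt
    have hga := hg.differentiableAt (D.isOpen.mem_nhds hz)
    -- Compare `(k + 1) * |g z| ^ k * Q_g(z) ≤ ‖S‖ ^ (k + 1)` with `‖S‖ < |g z|` and cancel `|g z| ^
    -- k`.
    have key : ∀ k : ℕ, (k : ℝ≥0∞) * Q D.carrier g z ≤ ENNReal.ofReal ‖g z‖ := by
      intro k
      rcases k with _ | k
      · simp
      have hb : Q D.carrier (ι ((S ^ (k + 1)) e)) z ≤ ENNReal.ofReal (‖S‖ ^ (k + 1)) := by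
        refine (Q_le_beta _ hz).trans ?_
        rw [← ENNReal.ofReal_toReal (ι ((S ^ (k + 1)) e)).mem.2.2.ne]
        exact ENNReal.ofReal_le_ofReal
          ((BlochSpace.toReal_beta_le_norm _).trans (hnorm (k + 1)))
      have hder : fderiv ℂ (ι ((S ^ (k + 1)) e)).toFun z =
          fderiv ℂ (((k + 1 : ℕ) * g z ^ k : ℂ) • g) z := by
        rw [(Filter.eventuallyEq_of_mem (D.isOpen.mem_nhds hz) (hpow (k + 1))).fderiv_eq,
          fderiv_const_smul hga]
        simpa using (hga.hasFDerivAt.pow (k + 1)).fderiv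
      rw [Q_congr_fderiv _ hder, Q_smul _ hga, norm_mul, norm_pow, Complex.norm_natCast,
        mul_comm ((k + 1 : ℕ) : ℝ), ENNReal.ofReal_mul (by positivity), ENNReal.ofReal_natCast,
        mul_assoc] at hb
      have h2 : ENNReal.ofReal (‖S‖ ^ (k + 1)) ≤
          ENNReal.ofReal (‖g z‖ ^ k) * ENNReal.ofReal ‖g z‖ := by
        rw [← ENNReal.ofReal_mul (by positivity), ← pow_succ]
        exact ENNReal.ofReal_le_ofReal (by gcongr)
      have h0 : ENNReal.ofReal (‖g z‖ ^ k) ≠ 0 := by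
        exact (ENNReal.ofReal_pos.2 (pow_pos hgz k)).ne'
      exact (ENNReal.mul_le_mul_iff_right h0 ENNReal.ofReal_ne_top).1 (hb.trans h2)
    have hq := Q_ne_zero D.carrier hd
    obtain ⟨k, hk⟩ := ENNReal.exists_nat_mul_gt hq (ENNReal.ofReal_ne_top (r := ‖g z‖))
    exact absurd (key k) (not_le.2 hk)
  -- At the base point the norm controls the value directly; the first power of `S` suffices.
  · have h1 := (BlochSpace.norm_apply_base_le_norm (ι ((S ^ 1) e))).trans (hnorm 1)
    rwa [hpow 1 _ z₀.2, pow_one, pow_one] at h1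

theorem closure_image_subset_spectrum {e : X} (he : ∀ z ∈ D.carrier, ι e z = 1)
    {ψ : (Fin n → ℂ) → ℂ} (hψ : DifferentiableOn ℂ ψ D.carrier) (T : X →L[ℂ] X)
    (hT : ∀ x, ∀ z ∈ D.carrier, ι (T x) z = ψ z * ι x z) :
    closure (ψ '' D.carrier) ⊆ spectrum ℂ T := by
  intro c hc
  rw [spectrum.mem_iff]
  rintro ⟨u, hu⟩
  have hS : ∀ x, ∀ z ∈ D.carrier, (c - ψ z) * ι (u.inv x) z = ι x z := by
    intro x z hz
    have h1 : (algebraMap ℂ (X →L[ℂ] X) c - T) (u.inv x) = x := by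
      rw [← hu, ← mul_apply_eq_comp]
      exact congrArg (fun A : X →L[ℂ] X => A x) u.val_inv
    have h2 : c • u.inv x = x + T (u.inv x) := by
      rw [← sub_eq_iff_eq_add]
      simpa [Algebra.algebraMap_eq_smul_one] using h1
    have h3 := congrFun (congrArg (fun y => (ι y).toFun) h2) z
    simp only [map_smul, map_add, BlochSpace.toFun_smul, BlochSpace.toFun_add, Pi.smul_apply,
      Pi.add_apply, hT _ z hz, smul_eq_mul] at h3
    linear_combination h3
  have hne : ∀ z ∈ D.carrier, c - ψ z ≠ 0 := by
    intro z hz h0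
    have := hS e z hz
    rw [h0, he z hz, zero_mul] at this
    exact zero_ne_one this
  have hb : ∀ z ∈ D.carrier, ‖(c - ψ z)⁻¹‖ ≤ ‖u.inv‖ := fun z hz =>
    norm_symbol_le (g := fun z => (c - ψ z)⁻¹) he
      (((differentiableOn_const c).sub hψ).inv hne) u.inv
      (fun x z hz => by rw [← hS x z hz, inv_mul_cancel_left₀ (hne z hz)]) hz
  obtain ⟨_, ⟨z, hz, rfl⟩, hlt⟩ := Metric.mem_closure_iff.1 hc (‖u.inv‖ + 1)⁻¹ (by positivity)
  have h1 := hb z hz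
  have h2 : 0 < ‖c - ψ z‖ := norm_pos_iff.2 (hne z hz)
  rw [dist_eq_norm, lt_inv_comm₀ h2 (by positivity), ← norm_inv] at hlt
  linarith

/-! ### The resolvent off the closure of the range -/

/-- In the quotient rule, `f ψ'` is replaced by `(ψ f)' - ψ f'`, and then `ψ` by `c - (c - ψ)`. No
bound on `ψ'` is then needed. -/
theorem fderiv_resolvent_mul {f p h ψ : (Fin n → ℂ) → ℂ} {z : Fin n → ℂ} {c : ℂ}
    (hf : DifferentiableAt ℂ f z) (hψ : DifferentiableAt ℂ ψ z) (hc : c - ψ z ≠ 0)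
    (hp : p =ᶠ[𝓝 z] fun w => ψ w * f w) (hh : h =ᶠ[𝓝 z] fun w => (c - ψ w)⁻¹ * f w) :
    fderiv ℂ h z = ((c - ψ z)⁻¹ * (2 - c * (c - ψ z)⁻¹)) • fderiv ℂ f z +
      ((c - ψ z)⁻¹ ^ 2) • fderiv ℂ p z := by
  have h1 : HasFDerivAt (fun w => (c - ψ w)⁻¹ * f w) _ z :=
    ((hasDerivAt_inv hc).comp_hasFDerivAt z
      ((hasFDerivAt_const c z).sub hψ.hasFDerivAt)).mul hf.hasFDerivAt
  rw [hp.fderiv_eq, hh.fderiv_eq, h1.fderiv, fderiv_fun_mul hψ hf]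
  ext u
  simp
  field_simp
  ring

/-- Hypothesis `hX` is the only property of `X` used: it contains every Bloch function whose `Q` is
dominated by those of two of its members, here `x` and `T x`. -/
theorem spectrum_subset_closure_image
    (hX : ∀ (f : BlochSpace D z₀) (x y : X) (C : ℝ), (∀ z ∈ D.carrier, Q D.carrier f z ≤
      ENNReal.ofReal C * (Q D.carrier (ι x) z + Q D.carrier (ι y) z)) → f ∈ range ι)
    {ψ : (Fin n → ℂ) → ℂ} (hψ : DifferentiableOn ℂ ψ D.carrier) (T : X →L[ℂ] X)
    (hT : ∀ x, ∀ z ∈ D.carrier, ι (T x) z = ψ z * ι x z) :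
    spectrum ℂ T ⊆ closure (ψ '' D.carrier) := by
  intro c
  contrapose!
  intro hc
  obtain ⟨δ, hδ, hdist⟩ : ∃ δ > 0, ∀ z ∈ D.carrier, δ ≤ ‖c - ψ z‖ := by
    simpa [Metric.mem_closure_iff, dist_eq_norm] using hc
  have hne : ∀ z ∈ D.carrier, c - ψ z ≠ 0 := fun z hz =>
    norm_pos_iff.1 (hδ.trans_le (hdist z hz))
  have hinv : ∀ z ∈ D.carrier, ‖(c - ψ z)⁻¹‖ ≤ δ⁻¹ := fun z hz => by
    rw [norm_inv]
    exact inv_anti₀ hδ (hdist z hz)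
  -- The two summands bound the two coefficients in `fderiv_resolvent_mul`.
  set C : ℝ := δ⁻¹ * (2 + ‖c‖ * δ⁻¹) + δ⁻¹ ^ 2 with hC
  have hC0 : 0 ≤ C := by positivity
  -- The cut-off is needed because elements of the Bloch space vanish off `D`.
  let G : X → (Fin n → ℂ) → ℂ := fun x => D.carrier.indicator fun z => (c - ψ z)⁻¹ * ι x z
  have hG : ∀ x, ∀ z ∈ D.carrier, G x z = (c - ψ z)⁻¹ * ι x z := fun x z hz =>
    indicator_of_mem hz _
  have hQ : ∀ x, ∀ z ∈ D.carrier, Q D.carrier (G x) z ≤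
      ENNReal.ofReal C * (Q D.carrier (ι x) z + Q D.carrier (ι (T x)) z) := by
    intro x z hz
    have hnhds := D.isOpen.mem_nhds hz
    refine (Q_le_of_fderiv_eq D.carrier ((ι x).differentiableAt hz)
      ((ι (T x)).differentiableAt hz)
      (fderiv_resolvent_mul ((ι x).differentiableAt hz) (hψ.differentiableAt hnhds) (hne z hz)
        (eventuallyEq_of_mem hnhds (hT x)) (eventuallyEq_of_mem hnhds (hG x)))).trans ?_
    rw [mul_add]
    have h1 := hinv z hz
    gcongr
    · calc ‖(c - ψ z)⁻¹ * (2 - c * (c - ψ z)⁻¹)‖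
          ≤ ‖(c - ψ z)⁻¹‖ * (2 + ‖c‖ * ‖(c - ψ z)⁻¹‖) := by
            rw [norm_mul]
            gcongr
            refine (norm_sub_le _ _).trans ?_
            rw [norm_mul]
            simp
        _ ≤ δ⁻¹ * (2 + ‖c‖ * δ⁻¹) := by gcongr
        _ ≤ C := by rw [hC]; linarith [sq_nonneg δ⁻¹]
    · calc ‖(c - ψ z)⁻¹ ^ 2‖ ≤ δ⁻¹ ^ 2 := by rw [norm_pow]; gcongr
        _ ≤ C := by
          rw [hC]
          have : 0 ≤ δ⁻¹ * (2 + ‖c‖ * δ⁻¹) := by positivity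
          linarith
  have hbeta : ∀ x, beta D.carrier (G x) ≤
      ENNReal.ofReal C * (beta D.carrier (ι x) + beta D.carrier (ι (T x))) := by
    intro x
    refine iSup₂_le fun z hz => (hQ x z hz).trans ?_
    gcongr <;> exact Q_le_beta _ hz
  have hfin : ∀ x, ENNReal.ofReal C * (beta D.carrier (ι x) + beta D.carrier (ι (T x))) < ∞ :=
    fun x => ENNReal.mul_lt_top ENNReal.ofReal_lt_top
      (ENNReal.add_lt_top.2 ⟨(ι x).mem.2.2, (ι (T x)).mem.2.2⟩)
  have hmem : ∀ x, G x ∈ blochFunctions D := fun x =>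
    ⟨((((differentiableOn_const c).sub hψ).inv hne).mul (ι x).mem.1).congr (hG x),
      fun z hz => indicator_of_notMem hz _, (hbeta x).trans_lt (hfin x)⟩
  have hex : ∀ x, ∃ y, (ι y).toFun = G x := by
    intro x
    obtain ⟨y, hy⟩ := hX (⟨G x, hmem x⟩ : blochFunctions D) x (T x) C (hQ x)
    exact ⟨y, by rw [hy]; rfl⟩
  choose F hF using hex
  have hFz : ∀ x, ∀ z ∈ D.carrier, ι (F x) z = (c - ψ z)⁻¹ * ι x z := fun x z hz => by
    rw [hF, hG x z hz]
  have hlift : ∀ {x y : X}, (∀ z ∈ D.carrier, ι x z = ι y z) → x = y := fun h =>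
    ι.injective (BlochSpace.ext_on h)
  let S₀ : X →ₗ[ℂ] X :=
    { toFun := F
      map_add' := fun x y => hlift fun z hz => by
        simp only [map_add, BlochSpace.toFun_add, Pi.add_apply, hFz _ z hz, mul_add]
      map_smul' := fun a x => hlift fun z hz => by
        simp only [map_smul, BlochSpace.toFun_smul, Pi.smul_apply, hFz _ z hz, smul_eq_mul,
          RingHom.id_apply]
        ring }
  have hbound : ∀ x, ‖S₀ x‖ ≤ (δ⁻¹ + C * (1 + ‖T‖)) * ‖x‖ := by
    intro x
    have h1 : ‖ι (F x) z₀‖ ≤ δ⁻¹ * ‖x‖ := by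
      rw [hFz x _ z₀.2, norm_mul, ← ι.norm_map x]
      exact mul_le_mul (hinv _ z₀.2) (BlochSpace.norm_apply_base_le_norm _) (norm_nonneg _)
        (by positivity)
    have h2 : (beta D.carrier (ι (F x))).toReal ≤ C * (‖x‖ + ‖T‖ * ‖x‖) := by
      have := ENNReal.toReal_mono (hfin x).ne (hbeta x)
      rw [ENNReal.toReal_mul, ENNReal.toReal_ofReal hC0,
        ENNReal.toReal_add (ι x).mem.2.2.ne (ι (T x)).mem.2.2.ne] at this
      rw [hF]
      refine this.trans ?_
      gcongr
      · exact (BlochSpace.toReal_beta_le_norm _).trans (ι.norm_map x).le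
      · exact (BlochSpace.toReal_beta_le_norm _).trans
          ((ι.norm_map _).le.trans (T.le_opNorm x))
    change ‖F x‖ ≤ _
    rw [← ι.norm_map, BlochSpace.norm_def]
    linarith
  let S : X →L[ℂ] X := S₀.mkContinuous _ hbound
  have hS : ∀ x, ∀ z ∈ D.carrier, ι (S x) z = (c - ψ z)⁻¹ * ι x z := hFz
  have hA : ∀ x, ∀ z ∈ D.carrier,
      ι ((algebraMap ℂ (X →L[ℂ] X) c - T) x) z = (c - ψ z) * ι x z := by
    intro x z hz
    have h1 : (algebraMap ℂ (X →L[ℂ] X) c - T) x + T x = c • x := by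
      simp [Algebra.algebraMap_eq_smul_one]
    have h3 := congrFun (congrArg (fun y => (ι y).toFun) h1) z
    simp only [map_smul, map_add, BlochSpace.toFun_smul, BlochSpace.toFun_add, Pi.smul_apply,
      Pi.add_apply, hT _ z hz, smul_eq_mul] at h3
    linear_combination h3
  rw [spectrum.mem_iff, not_not]
  refine ⟨⟨_, S, ?_, ?_⟩, rfl⟩
  · ext x
    refine hlift fun z hz => ?_
    rw [mul_apply_eq_comp, hA _ z hz, hS _ z hz, mul_inv_cancel_left₀ (hne z hz)]
    rfl
  · ext x
    refine hlift fun z hz => ?_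
    rw [mul_apply_eq_comp, hS _ z hz, hA _ z hz, inv_mul_cancel_left₀ (hne z hz)]
    rfl

end Embedded

/-! ### The constant function and domination in the two spaces -/

theorem fderiv_indicator_one {z : Fin n → ℂ} (hz : z ∈ D.carrier) :
    fderiv ℂ (D.carrier.indicator fun _ => (1 : ℂ)) z = 0 := by
  rw [(eventuallyEq_of_mem (D.isOpen.mem_nhds hz)
    (fun w hw => indicator_of_mem hw _ : EqOn _ (fun _ => (1 : ℂ)) D.carrier)).fderiv_eq]
  simp

theorem Q_indicator_one {z : Fin n → ℂ} (hz : z ∈ D.carrier) :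
    Q D.carrier (D.carrier.indicator fun _ => (1 : ℂ)) z = 0 := by
  rw [Q_congr_fderiv (g := 0), Q_zero]
  rw [fderiv_indicator_one hz]
  simp

theorem indicator_one_mem_blochFunctions :
    (D.carrier.indicator fun _ => (1 : ℂ)) ∈ blochFunctions D := by
  refine ⟨(differentiableOn_const (1 : ℂ)).congr fun z hz => indicator_of_mem hz _,
    fun z hz => indicator_of_notMem hz _, ?_⟩
  have : beta D.carrier (D.carrier.indicator fun _ => (1 : ℂ)) = 0 :=
    le_antisymm (iSup₂_le fun z hz => (Q_indicator_one hz).le) bot_le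
  simp [this]

/-- The constant function `1` as an element of the Bloch space. -/
noncomputable def BlochSpace.one : BlochSpace D z₀ :=
  (⟨_, indicator_one_mem_blochFunctions⟩ : blochFunctions D)

theorem BlochSpace.one_apply {z : Fin n → ℂ} (hz : z ∈ D.carrier) :
    (BlochSpace.one : BlochSpace D z₀) z = 1 :=
  indicator_of_mem (s := D.carrier) hz fun _ => (1 : ℂ)

theorem StarLittleBlochSpace.mem_of_Q_le {f x y : BlochSpace D z₀}
    (hx : x ∈ StarLittleBlochSpace D z₀) (hy : y ∈ StarLittleBlochSpace D z₀) {C : ℝ}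
    (h : ∀ z ∈ D.carrier, Q D.carrier f z ≤
      ENNReal.ofReal C * (Q D.carrier x z + Q D.carrier y z)) :
    f ∈ StarLittleBlochSpace D z₀ := by
  have h1 := ENNReal.Tendsto.const_mul (a := ENNReal.ofReal C) (Tendsto.add hx hy)
    (Or.inr ENNReal.ofReal_ne_top)
  rw [add_zero, mul_zero] at h1
  refine tendsto_of_tendsto_of_tendsto_of_le_of_le' tendsto_const_nhds h1
    (Eventually.of_forall fun _ => zero_le) ?_
  filter_upwards [mem_inf_of_right (mem_principal_self D.carrier)] with z hz using h z hz

theorem BlochSpace.one_mem_starLittle :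
    (BlochSpace.one : BlochSpace D z₀) ∈ StarLittleBlochSpace D z₀ := by
  have h0 := (StarLittleBlochSpace D z₀).zero_mem
  refine StarLittleBlochSpace.mem_of_Q_le h0 h0 (C := 0) fun z hz => ?_
  exact (Q_indicator_one hz).le.trans bot_le

end BlochSpaces

theorem mainTheorem3 {n : ℕ} (D : BlochSpaces.BoundedHomogeneousDomain n) (z₀ : D.carrier)
    (ψ : (Fin n → ℂ) → ℂ) (hψ : DifferentiableOn ℂ ψ D.carrier) :
    (∀ T : BlochSpaces.BlochSpace D z₀ →L[ℂ] BlochSpaces.BlochSpace D z₀,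
      BlochSpaces.IsMulOperator ψ T → spectrum ℂ T = closure (ψ '' D.carrier)) ∧
    (∀ T : BlochSpaces.StarLittleBlochSpace D z₀ →L[ℂ] BlochSpaces.StarLittleBlochSpace D z₀,
      BlochSpaces.IsStarLittleMulOperator ψ T →
        spectrum ℂ T = closure (ψ '' D.carrier)) := by
  refine ⟨fun T hT => ?_, fun T hT => ?_⟩
  · exact Subset.antisymm
      (BlochSpaces.spectrum_subset_closure_image (ι := LinearIsometry.id)
        (fun f _ _ _ _ => ⟨f, rfl⟩) hψ T hT)
      (BlochSpaces.closure_image_subset_spectrum (ι := LinearIsometry.id)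
        (e := BlochSpaces.BlochSpace.one)
        (fun _ hz => BlochSpaces.BlochSpace.one_apply hz) hψ T hT)
  · exact Subset.antisymm
      (BlochSpaces.spectrum_subset_closure_image
        (ι := (BlochSpaces.StarLittleBlochSpace D z₀).subtypeₗᵢ)
        (fun f x y _ h => ⟨⟨f, BlochSpaces.StarLittleBlochSpace.mem_of_Q_le x.2 y.2 h⟩, rfl⟩)
        hψ T hT)
      (BlochSpaces.closure_image_subset_spectrum
        (ι := (BlochSpaces.StarLittleBlochSpace D z₀).subtypeₗᵢ)
        (e := ⟨_, BlochSpaces.BlochSpace.one_mem_starLittle⟩)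
        (fun _ hz => BlochSpaces.BlochSpace.one_apply hz) hψ T hT)
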